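/- Let $\Sigma$ be an alphabet. An LZ-End factorization of a string $T\in\Sigma^*$ is a sequence $f_1,\dots,f_z$ of non-empty strings with $T=f_1\cdots f_z$ such that each $f_k$ is either a single character not occurring in $f_1\cdots f_{k-1}$, or a suffix of $f_1\cdots f_h$ for some $1\le h<k$. Let $z_{\mathrm{End}}^{\mathrm{opt}}(T)$ be the smallest number of phrases of an LZ-End factorization of $T$. For an edit type $e\in\{\mathrm{sub},\mathrm{ins},\mathrm{del}\}$ (substitution of one character by a different one, insertion of one character, deletion of one character) and $n\ge 1$ let $$\mathrm{MS}_e(n)=\max\left\{\frac{z_{\mathrm{End}}^{\mathrm{opt}}(T')}{z_{\mathrm{End}}^{\mathrm{opt}}(T)} : T\in\Sigma^n,\ T' \text{ is obtained from } T \text{ by one edit operation of type } e\right\},$$ and put $s_{\mathrm{sub}}=3$, $s_{\mathrm{del}}=3$, $s_{\mathrm{ins}}=2$. Then the multiplicative sensitivity of optimal LZ-End is $3$ for substitutions, $3$ for deletions and $2$ for insertions, in the following sense. For every alphabet $\Sigma$, every edit type $e$, every non-empty string $T$ over $\Sigma$, and every $T'$ obtained from $T$ by one edit operation of type $e$, $$z_{\mathrm{End}}^{\mathrm{opt}}(T')\le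 s_e\cdot z_{\mathrm{End}}^{\mathrm{opt}}(T).$$ Moreover, if $\Sigma$ is infinite (so that strings may use arbitrarily many distinct characters), then for every $e$ the maximum $\mathrm{MS}_e(n)$ exists and is at most $s_e$ for all $n\ge 1$, and $$\lim_{n\to\infty}\mathrm{MS}_e(n)=s_e .$$ -/

import Mathlib

namespace LZEnd

variable {α : Type*}

/-- `fs = [f₀, …, f_{z-1}]` is an LZ-End factorization of `T`: the phrases are non-empty, their
concatenation is `T`, and each phrase `f_k` is either a fresh character (one that does not occur in
`f₀ ⋯ f_{k-1}`), or a copy of a substring of `f₀ ⋯ f_{k-1}` that ends where one of the previous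
phrases ends, that is, a suffix of the concatenation of the first `h` phrases for some
`1 ≤ h ≤ k`. -/
def IsFactorization (T : List α) (fs : List (List α)) : Prop :=
  fs.flatten = T ∧
    ∀ (k : ℕ) (hk : k < fs.length), fs[k] ≠ [] ∧
      ((∃ c : α, fs[k] = [c] ∧ c ∉ (fs.take k).flatten) ∨
        ∃ h : ℕ, 1 ≤ h ∧ h ≤ k ∧ fs[k] <:+ (fs.take h).flatten)

/-- The size of the optimal LZ-End factorization: the least number of phrases of an LZ-End
factorization of `T`. -/
noncomputable def zEndOpt (T : List α) : ℕ :=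
  sInf {z : ℕ | ∃ fs : List (List α), IsFactorization T fs ∧ fs.length = z}

/-- Every string has an LZ-End factorization (into single characters). -/
theorem exists_isFactorization (T : List α) : ∃ fs, IsFactorization T fs := by
  have flat : ∀ S : List α, (S.map (fun c => [c])).flatten = S := by
    intro S
    induction S with
    | nil => rfl
    | cons a S ih => simp [ih]
  refine ⟨T.map (fun c => [c]), flat T, ?_⟩
  intro k hk
  have hk' : k < T.length := by simpa using hk
  refine ⟨by simp, ?_⟩
  by_cases hc : T[k] ∈ T.take k
  · right
    obtain ⟨i, hi, hik⟩ := List.getElem_of_mem hc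
    have hi' : i < k := by
      have := hi
      simp only [List.length_take] at this
      omega
    refine ⟨i + 1, by omega, by omega, ?_⟩
    rw [← List.map_take, flat, List.getElem_map, ← hik, List.getElem_take]
    rw [List.take_succ_eq_append_getElem (by omega)]
    exact List.suffix_append _ _
  · left
    refine ⟨T[k], by simp, ?_⟩
    rw [← List.map_take, flat]
    exact hc

/-- The minimum in the definition of `zEndOpt` is attained. -/
theorem exists_optimal (T : List α) : ∃ fs, IsFactorization T fs ∧ fs.length = zEndOpt T := by
  obtain ⟨fs, hfs⟩ := exists_isFactorization T
  exact Nat.sInf_mem (s := {z : ℕ | ∃ fs : List (List α), IsFactorization T fs ∧ fs.length = z})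
    ⟨fs.length, fs, hfs, rfl⟩

/-- The three types of single-character edit operations. -/
inductive Edit
  | sub
  | ins
  | del

/-- `IsEdit e T T'`: the string `T'` is obtained from `T` by one edit operation of type `e`
(substitution of one character by a different one, insertion of one character, deletion of one
character). -/
def IsEdit : Edit → List α → List α → Prop
  | .sub, T, T' => ∃ (u v : List α) (a b : α), a ≠ b ∧ T = u ++ a :: v ∧ T' = u ++ b :: v
  | .ins, T, T' => ∃ (u v : List α) (b : α), T = u ++ v ∧ T' = u ++ b :: v
  | .del, T, T' => ∃ (u v : List α) (a : α), T = u ++ a :: v ∧ T' = u ++ v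

/-- The set of all ratios `c(T') / c(T)`, where `T` has length `n` and `T'` is obtained from `T`
by one edit operation of type `e`. -/
def ratios (e : Edit) (c : List α → ℕ) (n : ℕ) : Set ℝ :=
  {r | ∃ T T' : List α, T.length = n ∧ IsEdit e T T' ∧ r = (c T' : ℝ) / (c T : ℝ)}

/-- The worst-case multiplicative sensitivity of the measure `c` at length `n`: the largest
element of `ratios e c n`. -/
noncomputable def MS (e : Edit) (c : List α → ℕ) (n : ℕ) : ℝ :=
  sSup (ratios e c n)

/-- The claimed multiplicative sensitivity of optimal LZ-End for each type of edit operation. -/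
def msValue : Edit → ℕ
  | .sub => 3
  | .ins => 2
  | .del => 3

end LZEnd

/-!
A phrase that is copied from an earlier boundary can be recut after the edit: if its source
straddles the edited letter, the part before the edit is a suffix of the part of the string before
the edit, the part after it still ends at a boundary, and the edited letter, if the original string
has one there, costs one more phrase. This gives three phrases per phrase for a substitution or a
deletion and two for an insertion. In the one phrase hit by the edit, the piece before the edit is
recut at the old boundaries.

For the converse, a first occurrence of a string contains a boundary before its last letter. The
worst-case string starts with a long ramp, so that each level of the Zimin word behind it is a copy
of a suffix of what precedes and costs one phrase. Spoiling the separator after the ramp makes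
three (two for an insertion) disjoint strings in each level occur for the first time, so each level
costs that many phrases, while the ramp itself costs only logarithmically many.
-/

namespace LZEnd

/-! ### Parses and their boundaries -/

section Parse

variable {α : Type*}

/-- A string that a parse with set of boundaries `B` may append as its next phrase. In contrast to
a phrase of an LZ-End factorization it may be empty, and a single character need not be fresh;
this relaxation does not change the least number of phrases. -/
def IsPhrase (B : Set (List α)) (f : List α) : Prop :=
  f.length ≤ 1 ∨ ∃ P ∈ B, f <:+ P

/-- `Parse n T B`: the string `T` is a concatenation of `n` successive phrases, and `B` is the set
of its *boundaries*, the concatenations of leading phrases. A boundary is recorded as the prefix of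
`T` that it ends rather than as a position. -/
inductive Parse : ℕ → List α → Set (List α) → Prop
  | nil : Parse 0 [] {[]}
  | snoc {n : ℕ} {T f : List α} {B : Set (List α)} (h : Parse n T B) (hf : IsPhrase B f) :
      Parse (n + 1) (T ++ f) (insert (T ++ f) B)

/-- `Parsable n T B`: the string `T` has a parse into at most `n` phrases whose boundaries include
all members of `B`. -/
def Parsable (n : ℕ) (T : List α) (B : Set (List α)) : Prop :=
  ∃ m ≤ n, ∃ C, B ⊆ C ∧ Parse m T C

theorem IsPhrase.mono {B C : Set (List α)} {f : List α} (hf : IsPhrase B f) (hBC : B ⊆ C) :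
    IsPhrase C f :=
  hf.imp_right fun ⟨P, hP, hfP⟩ => ⟨P, hBC hP, hfP⟩

theorem IsPhrase.of_suffix {B : Set (List α)} {f g : List α} (hf : IsPhrase B f) (hg : g <:+ f) :
    IsPhrase B g :=
  hf.imp hg.length_le.trans fun ⟨P, hP, hfP⟩ => ⟨P, hP, hg.trans hfP⟩

namespace Parse

variable {n : ℕ} {T : List α} {B : Set (List α)}

theorem self_mem (h : Parse n T B) : T ∈ B := by
  cases h <;> simp

theorem prefix_of_mem (h : Parse n T B) {P : List α} (hP : P ∈ B) : P <+: T := by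
  induction h with
  | nil => simp_all
  | snoc _ _ ih =>
    rcases hP with rfl | hP
    · exact List.prefix_rfl
    · exact (ih hP).trans (List.prefix_append _ _)

theorem finite (h : Parse n T B) : B.Finite := by
  induction h with
  | nil => exact Set.finite_singleton _
  | snoc _ _ ih => exact ih.insert _

theorem ncard_le (h : Parse n T B) : B.ncard ≤ n + 1 := by
  induction h with
  | nil => simp
  | snoc _ _ ih => exact (Set.ncard_insert_le _ _).trans (Nat.succ_le_succ ih)

theorem exists_mem_singleton_suffix (h : Parse n T B) {c : α} (hc : c ∈ T) :
    ∃ P ∈ B, [c] <:+ P := by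
  induction h with
  | nil => simp at hc
  | @snoc n T f B h hf ih =>
    by_cases hcT : c ∈ T
    · obtain ⟨P, hP, hcP⟩ := ih hcT
      exact ⟨P, Or.inr hP, hcP⟩
    have hcf : c ∈ f := (List.mem_append.1 hc).resolve_left hcT
    rcases hf with hf | ⟨P, hP, hfP⟩
    · obtain rfl : f = [c] := by
        match f, hf with
        | [d], _ => simpa [eq_comm] using hcf
      exact ⟨_, Or.inl rfl, List.suffix_append _ _⟩
    · exact absurd ((h.prefix_of_mem hP).subset (hfP.subset hcf)) hcT

theorem infix_of_isPhrase_append (h : Parse n T B) {x y : List α} (hxy : IsPhrase B (x ++ y))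
    (hy : y ≠ []) : x <:+: T := by
  rcases hxy with hlen | ⟨P, hP, hxyP⟩
  · obtain rfl : x = [] := by
      have := List.length_pos_iff.2 hy
      rw [List.length_append] at hlen
      exact List.length_eq_zero_iff.1 (by omega)
    exact List.nil_infix
  · exact (List.prefix_append x y).isInfix.trans
      (hxyP.isInfix.trans (h.prefix_of_mem hP).isInfix)

theorem parsable (h : Parse n T B) : Parsable n T B :=
  ⟨n, le_rfl, B, subset_rfl, h⟩

theorem exists_of_length (T : List α) : ∃ B, Parse T.length T B := by
  induction T using List.reverseRecOn with
  | nil => exact ⟨_, .nil⟩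
  | append_singleton T c ih =>
    obtain ⟨B, h⟩ := ih
    exact ⟨_, by simpa using h.snoc (f := [c]) (Or.inl le_rfl)⟩

end Parse

namespace Parsable

variable {n m : ℕ} {T S f s x : List α} {B C : Set (List α)}

theorem mono (h : Parsable n T B) (hnm : n ≤ m) (hCB : C ⊆ B) : Parsable m T C := by
  obtain ⟨k, hk, D, hBD, hD⟩ := h
  exact ⟨k, hk.trans hnm, D, hCB.trans hBD, hD⟩

theorem insert_self (h : Parsable n T B) : Parsable n T (insert T B) := by
  obtain ⟨k, hk, D, hBD, hD⟩ := h
  exact ⟨k, hk, D, Set.insert_subset hD.self_mem hBD, hD⟩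

theorem snoc (h : Parsable n T B) (hf : IsPhrase B f) :
    Parsable (n + 1) (T ++ f) (insert (T ++ f) B) := by
  obtain ⟨k, hk, D, hBD, hD⟩ := h
  exact ⟨k + 1, Nat.succ_le_succ hk, _, Set.insert_subset_insert hBD, hD.snoc (hf.mono hBD)⟩

theorem snoc_of_length_le_one (h : Parsable n T B) (hs : s.length ≤ 1) :
    Parsable (n + s.length) (T ++ s) (insert (T ++ s) B) := by
  rcases Nat.le_one_iff_eq_zero_or_eq_one.1 hs with hs' | hs'
  · obtain rfl := List.length_eq_zero_iff.1 hs'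
    simpa using h.insert_self
  · simpa only [hs'] using h.snoc (Or.inl hs)

/-- Recutting `x` at the boundaries of `T` inside it leaves at most `n` pieces, each of which ends
at a boundary of `T` and is therefore a phrase. -/
theorem append_infix (hS : Parsable m S C) (hT : Parse n T B) (hBC : B ⊆ C) (hx : x <:+: T) :
    Parsable (m + n) (S ++ x) C := by
  induction hT generalizing x m S with
  | nil =>
    obtain rfl : x = [] := by simpa using hx
    simpa using hS
  | @snoc n T f B h hf ih =>
    obtain ⟨hTf, hBC'⟩ := Set.insert_subset_iff.1 hBC
    have of_infix {y : List α} (hy : y <:+: T) : Parsable (m + (n + 1)) (S ++ y) C :=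
      (ih hS hBC' hy).mono (by omega) subset_rfl
    have of_phrase {y : List α} (hy : IsPhrase C y) : Parsable (m + (n + 1)) (S ++ y) C :=
      (hS.snoc hy).mono (by omega) (Set.subset_insert _ _)
    rcases hf with hf | ⟨P, hP, hfP⟩
    · match f, hf with
      | [], _ => exact of_infix (by simpa using hx)
      | [c], _ =>
        rcases List.infix_concat_iff.1 hx with hx | hx
        · exact of_phrase (Or.inr ⟨_, hTf, hx⟩)
        · exact of_infix hx
    · have hfT : f <:+: T := hfP.isInfix.trans (h.prefix_of_mem hP).isInfix
      rcases List.infix_append_iff.1 hx with hx | hx | ⟨x₁, x₂, rfl, hx₁, hx₂⟩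
      · exact of_infix hx
      · exact of_infix (hx.trans hfT)
      · have hSx₁ := hS.snoc (f := x₁) (Or.inr ⟨T, hBC' h.self_mem, hx₁⟩)
        have hSx := ih (hSx₁.mono le_rfl (Set.subset_insert _ _)) hBC' (hx₂.isInfix.trans hfT)
        simpa [add_assoc, add_comm 1 n] using hSx

end Parsable

end Parse

/-! ### Parses compute the size of the optimal factorization -/

section Factorization

variable {α : Type*} {T f : List α} {fs : List (List α)}

/-- The boundaries of a factorization, recorded as in `Parse`. -/
def boundaries (fs : List (List α)) : Set (List α) :=
  {P | ∃ gs, gs <+: fs ∧ gs.flatten = P}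

theorem flatten_mem_boundaries (fs : List (List α)) : fs.flatten ∈ boundaries fs :=
  ⟨fs, List.prefix_rfl, rfl⟩

theorem boundaries_nil : boundaries ([] : List (List α)) = {[]} := by
  ext P
  simp [boundaries, eq_comm]

theorem boundaries_concat (fs : List (List α)) (f : List α) :
    boundaries (fs ++ [f]) = insert (fs.flatten ++ f) (boundaries fs) := by
  ext P
  simp [boundaries, List.prefix_concat_iff, or_and_right, exists_or, eq_comm]

theorem exists_suffix_flatten_take_iff (hf : f ≠ []) :
    (∃ h, 1 ≤ h ∧ h ≤ fs.length ∧ f <:+ (fs.take h).flatten) ↔ ∃ P ∈ boundaries fs, f <:+ P := by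
  constructor
  · rintro ⟨h, -, -, hfh⟩
    exact ⟨_, ⟨_, List.take_prefix h fs, rfl⟩, hfh⟩
  · rintro ⟨_, ⟨gs, hgs, rfl⟩, hfgs⟩
    have hne : gs ≠ [] := by
      rintro rfl
      exact hf (by simpa using hfgs)
    exact ⟨gs.length, List.length_pos_iff.2 hne, hgs.length_le,
      by rwa [← List.prefix_iff_eq_take.1 hgs]⟩

theorem isFactorization_iff_forall_prefix :
    IsFactorization T fs ↔ fs.flatten = T ∧ ∀ gs f, gs ++ [f] <+: fs →
      f ≠ [] ∧ ((∃ c, f = [c] ∧ c ∉ gs.flatten) ∨ ∃ P ∈ boundaries gs, f <:+ P) := by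
  refine and_congr_right fun _ => ⟨?_, fun h k hk => ?_⟩
  · rintro h gs f ⟨t, rfl⟩
    obtain ⟨hf, hfresh | ⟨i, hi, hik, hfi⟩⟩ := h gs.length (by simp)
    · exact ⟨by simpa using hf, Or.inl (by simpa using hfresh)⟩
    · have hf' : f ≠ [] := by simpa using hf
      refine ⟨hf', Or.inr ((exists_suffix_flatten_take_iff hf').1 ⟨i, hi, hik, ?_⟩)⟩
      simpa [List.take_append_of_le_length, hik] using hfi
  · obtain ⟨hf, hfresh | hcopy⟩ := h (fs.take k) fs[k] (by simp [List.take_prefix])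
    · exact ⟨hf, Or.inl hfresh⟩
    · obtain ⟨i, hi, hik, hfi⟩ := (exists_suffix_flatten_take_iff hf).2 hcopy
      rw [List.take_take] at hfi
      rw [List.length_take] at hik
      exact ⟨hf, Or.inr ⟨i, hi, by omega, by rwa [min_eq_left (by omega)] at hfi⟩⟩

theorem isFactorization_concat_iff :
    IsFactorization (fs.flatten ++ f) (fs ++ [f]) ↔ IsFactorization fs.flatten fs ∧ f ≠ [] ∧
      ((∃ c, f = [c] ∧ c ∉ fs.flatten) ∨ ∃ P ∈ boundaries fs, f <:+ P) := by
  simp only [isFactorization_iff_forall_prefix, List.prefix_concat_iff,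
    List.flatten_append, List.flatten_singleton, true_and]
  constructor
  · exact fun h => ⟨fun gs g hg => h gs g (Or.inr hg), h fs f (Or.inl rfl)⟩
  · rintro ⟨h, hf⟩ gs g (hg | hg)
    · obtain ⟨rfl, hgf⟩ := List.append_inj' hg rfl
      obtain rfl := List.singleton_inj.1 hgf
      exact hf
    · exact h gs g hg

theorem IsFactorization.parse (h : IsFactorization T fs) : Parse fs.length T (boundaries fs) := by
  obtain rfl := h.1
  induction fs using List.reverseRecOn with
  | nil => simpa [boundaries_nil] using Parse.nil
  | append_singleton fs f ih =>
    rw [List.flatten_append, List.flatten_singleton] at h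
    obtain ⟨hfs, -, hf⟩ := isFactorization_concat_iff.1 h
    have hphrase : IsPhrase (boundaries fs) f := by
      rcases hf with ⟨c, rfl, -⟩ | hcopy
      · exact Or.inl le_rfl
      · exact Or.inr hcopy
    simpa [boundaries_concat] using (ih hfs).snoc hphrase

theorem Parse.exists_isFactorization {n : ℕ} {B : Set (List α)} (h : Parse n T B) :
    ∃ fs, IsFactorization T fs ∧ fs.length ≤ n ∧ boundaries fs = B := by
  induction h with
  | nil => exact ⟨[], by simp [IsFactorization], le_rfl, boundaries_nil⟩
  | @snoc n T f B h hf ih =>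
    obtain ⟨fs, hfs, hlen, rfl⟩ := ih
    obtain rfl := hfs.1
    rcases eq_or_ne f [] with rfl | hne
    · exact ⟨fs, by simpa using hfs, hlen.trans n.le_succ, by
        rw [List.append_nil, Set.insert_eq_of_mem (flatten_mem_boundaries fs)]⟩
    refine ⟨fs ++ [f], isFactorization_concat_iff.2 ⟨hfs, hne, ?_⟩, by simpa using hlen,
      boundaries_concat fs f⟩
    rcases hf with hlen | hcopy
    · obtain ⟨c, rfl⟩ := List.length_eq_one_iff.1 (hlen.antisymm (List.length_pos_iff.2 hne))
      by_cases hc : c ∈ fs.flatten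
      · exact Or.inr (h.exists_mem_singleton_suffix hc)
      · exact Or.inl ⟨c, rfl, hc⟩
    · exact Or.inr hcopy

theorem exists_parse_zEndOpt (T : List α) : ∃ B, Parse (zEndOpt T) T B := by
  obtain ⟨fs, hfs, hlen⟩ := exists_optimal T
  rw [← hlen]
  exact ⟨_, hfs.parse⟩

theorem Parse.zEndOpt_le {n : ℕ} {B : Set (List α)} (h : Parse n T B) : zEndOpt T ≤ n := by
  obtain ⟨fs, hfs, hlen, -⟩ := h.exists_isFactorization
  exact (Nat.sInf_le (Exists.intro fs ⟨hfs, rfl⟩)).trans hlen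

theorem Parsable.zEndOpt_le {n : ℕ} {B : Set (List α)} (h : Parsable n T B) : zEndOpt T ≤ n := by
  obtain ⟨m, hm, C, -, hC⟩ := h
  exact hC.zEndOpt_le.trans hm

theorem zEndOpt_le_length (T : List α) : zEndOpt T ≤ T.length :=
  (Parse.exists_of_length T).choose_spec.zEndOpt_le

theorem zEndOpt_pos (hT : T ≠ []) : 0 < zEndOpt T := by
  obtain ⟨B, h⟩ := exists_parse_zEndOpt T
  refine Nat.pos_of_ne_zero fun h0 => hT ?_
  rw [h0] at h
  cases h
  rfl

end Factorization

/-! ### The effect of an edit -/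

section Edit

variable {α : Type*} {n m : ℕ} {T u v w s r f x : List α} {B : Set (List α)}

theorem exists_eq_append_of_length_le_one {c t : List α} (hs : s.length ≤ 1) (hc : c ≠ [])
    (h : s ++ v = c ++ t) : ∃ w, c = s ++ w ∧ v = w ++ t := by
  match s, hs, h with
  | [], _, h => exact ⟨c, rfl, h⟩
  | [a], _, h =>
    obtain ⟨b, c, rfl⟩ := List.exists_cons_of_ne_nil hc
    obtain ⟨rfl, hv⟩ := List.cons.inj h
    exact ⟨c, rfl, hv⟩

theorem append_eq_append_append_cases {A : List α} (hs : s.length ≤ 1)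
    (h : A ++ f = u ++ (s ++ v)) :
    (∃ x, u = A ++ x ∧ f = x ++ (s ++ v)) ∨
      ∃ w, s ++ w ≠ [] ∧ A = u ++ (s ++ w) ∧ v = w ++ f := by
  rcases List.append_eq_append_iff.1 h with ⟨x, hu, hf⟩ | ⟨c, hA, hc⟩
  · exact Or.inl ⟨x, hu, hf⟩
  · rcases eq_or_ne c [] with rfl | hne
    · exact Or.inl ⟨[], by simpa using hA.symm, by simpa using hc.symm⟩
    · obtain ⟨w, rfl, hv⟩ := exists_eq_append_of_length_le_one hs hne hc
      exact Or.inr ⟨w, hne, hA, hv⟩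

/-- The boundaries that a set `B` of boundaries of a string `u ++ s ++ v` leaves behind when `s` is
replaced by `r`: those inside `u` stay, those beyond `u` move along with the letters after `s`, and
there is a new one in front of the edit. -/
def editedBoundaries (u s r : List α) (B : Set (List α)) : Set (List α) :=
  insert u ({P ∈ B | P <+: u} ∪ {Q | ∃ w, s ++ w ≠ [] ∧ u ++ (s ++ w) ∈ B ∧ Q = u ++ (r ++ w)})

theorem mem_editedBoundaries_of_prefix {P : List α} (hP : P ∈ B) (hPu : P <+: u) :
    P ∈ editedBoundaries u s r B :=
  Or.inr (Or.inl ⟨hP, hPu⟩)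

theorem append_mem_editedBoundaries (hsw : s ++ w ≠ []) (hw : u ++ (s ++ w) ∈ B) :
    u ++ (r ++ w) ∈ editedBoundaries u s r B :=
  Or.inr (Or.inr ⟨w, hsw, hw, rfl⟩)

theorem editedBoundaries_insert_subset (hsv : s ++ v ≠ []) :
    editedBoundaries u s r (insert (u ++ (s ++ v)) B) ⊆
      insert (u ++ (r ++ v)) (editedBoundaries u s r B) := by
  rintro _ (rfl | ⟨rfl | hP, hPu⟩ | ⟨w, hsw, hw | hw, rfl⟩)
  · exact Or.inr (Or.inl rfl)
  · exact absurd (List.append_right_eq_self.1 (hPu.eq_of_length_le (by simp))) hsv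
  · exact Or.inr (mem_editedBoundaries_of_prefix hP hPu)
  · obtain rfl := List.append_cancel_left (List.append_cancel_left hw)
    exact Or.inl rfl
  · exact Or.inr (append_mem_editedBoundaries hsw hw)

theorem Parse.editedBoundaries_subset (h : Parse n T B) (hT : T <+: u) :
    editedBoundaries u s r B ⊆ insert u B := by
  rintro _ (rfl | ⟨hP, -⟩ | ⟨w, hsw, hw, rfl⟩)
  · exact Or.inl rfl
  · exact Or.inr hP
  · have hu : u ++ (s ++ w) <+: u := (h.prefix_of_mem hw).trans hT
    exact absurd (List.append_right_eq_self.1 (hu.eq_of_length_le (by simp))) hsw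

/-- The edit hits the last phrase: its part before the edit is recut at the boundaries of `T`. -/
theorem Parse.parsable_replace_of_infix (h : Parse n T B) (hx : x <:+: T) (hr : r.length ≤ 1)
    (hv : IsPhrase B v) :
    Parsable (2 * n + 2) (T ++ x ++ (r ++ v)) (editedBoundaries (T ++ x) s r B) := by
  have before := (h.parsable.append_infix h subset_rfl hx).insert_self
  have edited := before.snoc (f := r) (Or.inl hr)
  have after := edited.snoc
    (hv.mono ((Set.subset_insert _ _).trans (Set.subset_insert _ _)))
  rw [List.append_assoc] at after
  refine after.mono (by omega) ((h.editedBoundaries_subset (List.prefix_append T x)).trans ?_)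
  exact (Set.subset_insert _ _).trans (Set.subset_insert _ _)

/-- A phrase after the edit: if its source straddles the edit, it is cut into the parts before, at
and after the edited letter. -/
theorem Parsable.append_phrase_after_edit
    (h : Parsable m (u ++ (r ++ w)) (editedBoundaries u s r B)) (hs : s.length ≤ 1)
    (hB : ∀ P ∈ B, P <+: u ++ (s ++ w)) (hf : IsPhrase B f) :
    Parsable (m + (2 + s.length)) (u ++ (r ++ (w ++ f))) (editedBoundaries u s r B) := by
  have append_phrase (hf : IsPhrase (editedBoundaries u s r B) f) :
      Parsable (m + (2 + s.length)) (u ++ (r ++ (w ++ f))) (editedBoundaries u s r B) := by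
    simpa using (h.snoc hf).mono (by omega) (Set.subset_insert _ _)
  rcases hf with hf | ⟨P, hP, ⟨t, rfl⟩⟩
  · exact append_phrase (Or.inl hf)
  obtain ⟨y, hy⟩ := hB _ hP
  rcases append_eq_append_append_cases hs hy with ⟨z, hu, -⟩ | ⟨w', hw', htf, -⟩
  · exact append_phrase
      (Or.inr ⟨_, mem_editedBoundaries_of_prefix hP ⟨z, hu.symm⟩, List.suffix_append t f⟩)
  have hmem : u ++ (r ++ w') ∈ editedBoundaries u s r B :=
    append_mem_editedBoundaries hw' (htf ▸ hP)
  rcases append_eq_append_append_cases hs htf with ⟨x, hu, rfl⟩ | ⟨w'', -, -, rfl⟩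
  · have hxu : x <:+ u := ⟨t, hu.symm⟩
    have hw'u : w' <:+ u ++ (r ++ w') := (List.suffix_append r w').trans (List.suffix_append u _)
    have front := h.snoc (Or.inr ⟨u, Or.inl rfl, hxu⟩)
    have letter := front.snoc_of_length_le_one hs
    have back := letter.snoc (Or.inr ⟨_, Or.inr (Or.inr hmem), hw'u⟩)
    rw [List.append_assoc, List.append_assoc, List.append_assoc, List.append_assoc] at back
    exact back.mono (by omega) ((Set.subset_insert _ _).trans
      ((Set.subset_insert _ _).trans (Set.subset_insert _ _)))
  · exact append_phrase (Or.inr ⟨_, hmem, (List.suffix_append w'' f).trans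
      ((List.suffix_append r _).trans (List.suffix_append u _))⟩)

theorem Parse.parsable_replace (h : Parse n (u ++ (s ++ v)) B) (hs : s.length ≤ 1)
    (hr : r.length ≤ 1) (hsv : s ++ v ≠ []) :
    Parsable ((2 + s.length) * n) (u ++ (r ++ v)) (editedBoundaries u s r B) := by
  generalize hT : u ++ (s ++ v) = T at h
  induction h generalizing v with
  | nil => simp_all
  | @snoc n T f B h hf ih =>
    have last_phrase (hB : Parsable ((2 + s.length) * n + (2 + s.length)) (u ++ (r ++ v))
        (editedBoundaries u s r B)) : Parsable ((2 + s.length) * (n + 1)) (u ++ (r ++ v))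
          (editedBoundaries u s r (insert (T ++ f) B)) := by
      rw [← hT]
      exact hB.insert_self.mono le_rfl (editedBoundaries_insert_subset hsv)
    rcases append_eq_append_append_cases hs hT.symm with ⟨x, rfl, rfl⟩ | ⟨w, hsw, rfl, rfl⟩
    · have hx : x <:+: T := h.infix_of_isPhrase_append hf hsv
      have hv : IsPhrase B v :=
        hf.of_suffix ((List.suffix_append s v).trans (List.suffix_append x _))
      exact last_phrase ((h.parsable_replace_of_infix hx hr hv).mono (by nlinarith) subset_rfl)
    · exact last_phrase ((ih hsw rfl).append_phrase_after_edit hs (fun _ => h.prefix_of_mem) hf)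

theorem zEndOpt_replace_le (u : List α) (hs : s.length ≤ 1) (hr : r.length ≤ 1)
    (hsv : s ++ v ≠ []) :
    zEndOpt (u ++ (r ++ v)) ≤ (2 + s.length) * zEndOpt (u ++ (s ++ v)) := by
  obtain ⟨B, hB⟩ := exists_parse_zEndOpt (u ++ (s ++ v))
  exact (hB.parsable_replace hs hr hsv).zEndOpt_le

theorem zEndOpt_concat_le (T : List α) (c : α) : zEndOpt (T ++ [c]) ≤ zEndOpt T + 1 := by
  obtain ⟨B, hB⟩ := exists_parse_zEndOpt T
  exact (hB.snoc (Or.inl le_rfl)).zEndOpt_le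

theorem zEndOpt_le_of_isEdit {e : Edit} {T' : List α} (hT : T ≠ []) (h : IsEdit e T T') :
    zEndOpt T' ≤ msValue e * zEndOpt T := by
  cases e with
  | sub =>
    obtain ⟨u, v, a, b, -, rfl, rfl⟩ := h
    exact zEndOpt_replace_le u (s := [a]) (r := [b]) le_rfl le_rfl (List.cons_ne_nil a v)
  | del =>
    obtain ⟨u, v, a, rfl, rfl⟩ := h
    exact zEndOpt_replace_le u (s := [a]) (r := []) le_rfl zero_le_one (List.cons_ne_nil a v)
  | ins =>
    obtain ⟨u, v, b, rfl, rfl⟩ := h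
    rcases eq_or_ne v [] with rfl | hv
    · rw [List.append_nil] at hT ⊢
      calc zEndOpt (u ++ [b]) ≤ zEndOpt u + 1 := zEndOpt_concat_le u b
        _ ≤ zEndOpt u + zEndOpt u := Nat.add_le_add_left (zEndOpt_pos hT) _
        _ = msValue .ins * zEndOpt u := (two_mul _).symm
    · exact zEndOpt_replace_le u (s := []) (r := [b]) zero_le_one le_rfl hv

end Edit

/-! ### Counting boundaries -/

section BoundaryCount

variable {α : Type*} {n p q : ℕ} {T A W : List α} {a : α} {B : Set (List α)}

theorem Parse.exists_boundary (h : Parse n T B) (hT : A ++ W ++ [a] <+: T) (hW : W ≠ [])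
    (hnew : ¬ W ++ [a] <:+: A) : ∃ P ∈ B, A.length < P.length ∧ P.length ≤ (A ++ W).length := by
  induction h with
  | nil => simp at hT
  | @snoc n T f B h hf ih =>
    by_cases hprefix : A ++ W ++ [a] <+: T
    · obtain ⟨P, hP, hlen⟩ := ih hprefix
      exact ⟨P, Or.inr hP, hlen⟩
    have hlt : T.length ≤ (A ++ W).length := by
      by_contra! hlt
      exact hprefix (List.prefix_of_prefix_length_le hT (List.prefix_append T f)
        (by rwa [List.length_append, List.length_singleton]))
    refine ⟨T, Or.inr h.self_mem, ?_, hlt⟩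
    by_contra! hle
    obtain ⟨D, rfl⟩ : T <+: A := List.prefix_of_prefix_length_le (List.prefix_append T f)
      (((List.prefix_append A W).trans (List.prefix_append _ [a])).trans hT) hle
    simp only [List.append_assoc, List.prefix_append_right_inj] at hT
    have hWf : W ++ [a] <:+: f := (List.suffix_append D _).isInfix.trans hT.isInfix
    rcases hf with hf | ⟨P, hP, hfP⟩
    · have := List.length_pos_iff.2 hW
      have := hWf.length_le
      simp only [List.length_append, List.length_singleton] at this
      omega
    · exact hnew (hWf.trans (hfP.isInfix.trans ((h.prefix_of_mem hP).trans
        (List.prefix_append T D)).isInfix))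

/-- The number of boundaries at positions up to `p`. -/
noncomputable def boundaryCount (B : Set (List α)) (p : ℕ) : ℕ :=
  {P ∈ B | P.length ≤ p}.ncard

theorem Parse.boundaryCount_mono (h : Parse n T B) (hpq : p ≤ q) :
    boundaryCount B p ≤ boundaryCount B q :=
  Set.ncard_le_ncard (fun _ hP => ⟨hP.1, hP.2.trans hpq⟩) (h.finite.subset (Set.sep_subset _ _))

theorem Parse.boundaryCount_le (h : Parse n T B) : boundaryCount B p ≤ n + 1 :=
  (Set.ncard_le_ncard (Set.sep_subset _ _) h.finite).trans h.ncard_le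

theorem Parse.boundaryCount_lt (h : Parse n T B) (hT : A ++ W ++ [a] <+: T) (hW : W ≠ [])
    (hnew : ¬ W ++ [a] <:+: A) : boundaryCount B A.length < boundaryCount B (A ++ W).length := by
  obtain ⟨P, hP, hlt, hle⟩ := h.exists_boundary hT hW hnew
  refine Set.ncard_lt_ncard (Set.ssubset_iff_subset_ne.2 ⟨fun Q hQ => ⟨hQ.1, hQ.2.trans ?_⟩, ?_⟩)
    (h.finite.subset (Set.sep_subset _ _))
  · exact (List.prefix_append A W).length_le
  · exact fun heq => hlt.not_ge (heq.ge ⟨hP, hle⟩).2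

end BoundaryCount

/-! ### Ramps and blocks -/

section Blocks

/-- The alphabet of the worst-case strings: three letters used periodically and two separators. -/
abbrev Letter : Type := ZMod 3 ⊕ Bool

/-- The periodic letters. -/
abbrev digit (i : ℕ) : Letter := .inl i

/-- The separator in front of a `dollar`. -/
abbrev hash : Letter := .inr false

/-- The separator after a `hash`. -/
abbrev dollar : Letter := .inr true

/-- The string of `i` letters with period three that ends with `digit 2, digit 1`; hence shorter
ramps are suffixes of longer ones. -/
def ramp : ℕ → List Letter
  | 0 => []
  | i + 1 => digit (i + 1) :: ramp i

/-- The concatenation of the blocks `ramp i ++ [hash, dollar]` for the members `i` of a list. -/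
def blocks : List ℕ → List Letter
  | [] => []
  | i :: w => ramp i ++ hash :: dollar :: blocks w

variable {A C D Q : List Letter} {Z w : List ℕ} {i : ℕ}

theorem length_ramp (i : ℕ) : (ramp i).length = i := by
  induction i <;> simp_all [ramp]

theorem hash_notMem_ramp (i : ℕ) : hash ∉ ramp i := by
  induction i <;> simp_all [ramp]

theorem dollar_notMem_ramp (i : ℕ) : dollar ∉ ramp i := by
  induction i <;> simp_all [ramp]

theorem blocks_append (v w : List ℕ) : blocks (v ++ w) = blocks v ++ blocks w := by
  induction v <;> simp_all [blocks]

theorem append_cons_eq_append_cases {α : Type*} {A C X Y : List α} {a : α}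
    (h : A ++ a :: C = X ++ Y) :
    (∃ E, X = A ++ a :: E ∧ C = E ++ Y) ∨ ∃ D, A = X ++ D ∧ D ++ a :: C = Y := by
  rcases List.append_eq_append_iff.1 h with ⟨E, hX, hE⟩ | ⟨D, hA, hY⟩
  · rcases List.cons_eq_append_iff.1 hE with ⟨rfl, hY⟩ | ⟨E, rfl, hC⟩
    · exact Or.inr ⟨[], by simpa using hX.symm, by simpa using hY.symm⟩
    · exact Or.inl ⟨E, hX, hC⟩
  · exact Or.inr ⟨D, hA, hY.symm⟩

theorem exists_eq_of_append_hash_eq (hQ : hash ∉ Q)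
    (h : A ++ hash :: C = Q ++ dollar :: blocks w) :
    ∃ w₁ t w₂, w = w₁ ++ t :: w₂ ∧ A = Q ++ dollar :: (blocks w₁ ++ ramp t) ∧
      C = dollar :: blocks w₂ := by
  induction w generalizing A Q with
  | nil =>
    have : hash ∈ Q ++ [dollar] := by
      rw [← blocks, ← h]
      simp
    simp [hQ] at this
  | cons i w ih =>
    have h' : A ++ hash :: C = (Q ++ dollar :: ramp i) ++ hash :: dollar :: blocks w := by
      simpa [blocks] using h
    rcases append_cons_eq_append_cases h' with ⟨E, hE, -⟩ | ⟨D, rfl, hD⟩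
    · have : hash ∈ Q ++ dollar :: ramp i := by simp [hE]
      simp [hQ, hash_notMem_ramp] at this
    · rcases List.append_eq_cons_iff.1 hD with ⟨rfl, hC⟩ | ⟨D, rfl, hDC⟩
      · exact ⟨[], i, w, rfl, by simp [blocks], (List.cons.inj hC).2⟩
      · obtain ⟨w₁, t, w₂, rfl, rfl, rfl⟩ := ih (Q := []) (by simp) hDC.symm
        exact ⟨i :: w₁, t, w₂, rfl, by simp [blocks], rfl⟩

theorem exists_eq_cons_of_ramp_append_hash_eq (h : ramp i ++ hash :: C = blocks w) :
    ∃ w', w = i :: w' ∧ C = dollar :: blocks w' := by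
  obtain ⟨_ | ⟨s, w₁⟩, t, w₂, rfl, hA, hC⟩ :=
    exists_eq_of_append_hash_eq (A := dollar :: ramp i) (Q := []) (C := C) (w := w)
      (by simp) (by simpa using h)
  · have hit : ramp i = ramp t := by simpa [blocks] using hA
    obtain rfl : i = t := by simpa [length_ramp] using congrArg List.length hit
    exact ⟨w₂, rfl, hC⟩
  · have hi : ramp i = ramp s ++ hash :: dollar :: (blocks w₁ ++ ramp t) := by
      simpa [blocks] using hA
    exact absurd (hi ▸ List.mem_append_right _ List.mem_cons_self) (hash_notMem_ramp i)

theorem exists_eq_append_of_blocks_append_eq (h : blocks Z ++ D = blocks w) :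
    ∃ w', w = Z ++ w' ∧ D = blocks w' := by
  induction Z generalizing w with
  | nil => exact ⟨w, rfl, h⟩
  | cons i Z ih =>
    simp only [blocks, List.append_assoc, List.cons_append] at h
    obtain ⟨w', rfl, hw'⟩ := exists_eq_cons_of_ramp_append_hash_eq h
    obtain ⟨w'', rfl, hD⟩ := ih (List.cons.inj hw').2
    exact ⟨w'', rfl, hD⟩

theorem exists_append_dollar_eq (Q : List Letter) (w : List ℕ) :
    ∃ X, Q ++ dollar :: blocks w = X ++ [dollar] := by
  induction w generalizing Q with
  | nil => exact ⟨Q, rfl⟩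
  | cons i w ih =>
    obtain ⟨X, hX⟩ := ih (Q ++ dollar :: (ramp i ++ [hash]))
    exact ⟨X, by simpa [blocks] using hX⟩

end Blocks

/-! ### First occurrences in strings of blocks -/

section FirstOccurrence

variable {Q : List Letter} {z Z w : List ℕ} {b c j n t : ℕ}

theorem not_ramp_hash_infix_blocks (hQ : hash ∉ Q) (hw : ∀ t ∈ w, t < j) :
    ¬ ramp j ++ [hash] <:+: Q ++ dollar :: blocks w := by
  rintro ⟨A, C, h⟩
  obtain ⟨w₁, t, w₂, rfl, hA, -⟩ := exists_eq_of_append_hash_eq (A := A ++ ramp j) (C := C) hQ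
    (by simpa using h)
  obtain ⟨X, hX⟩ := exists_append_dollar_eq Q w₁
  have hA' : X ++ dollar :: ramp t = A ++ ramp j := by
    rw [hA, ← List.cons_append, ← List.append_assoc, hX]
    simp
  rcases append_cons_eq_append_cases hA' with ⟨E, -, hE⟩ | ⟨D, -, hD⟩
  · have hlen := congrArg List.length hE
    rw [List.length_append, length_ramp, length_ramp] at hlen
    have := hw t (by simp)
    omega
  · exact dollar_notMem_ramp j (hD ▸ by simp)

/-- Since `b` occurs only once in `Z ++ b :: Z ++ [c]`. -/
theorem not_blocks_ramp_hash_infix (hQ : hash ∉ Q) (hb : b ∉ Z) (hbc : b ≠ c) :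
    ¬ hash :: dollar :: (blocks Z ++ ramp b) ++ [hash] <:+:
      Q ++ dollar :: blocks (Z ++ b :: Z) ++ ramp c := by
  rintro ⟨A, C, h⟩
  have h' : A ++ hash :: dollar :: (blocks Z ++ (ramp b ++ hash :: (C ++ [hash, dollar]))) =
      Q ++ dollar :: blocks (Z ++ b :: (Z ++ [c])) := by
    simpa [blocks, blocks_append] using congrArg (· ++ [hash, dollar]) h
  obtain ⟨w₁, t, w₂, hw, -, hC⟩ := exists_eq_of_append_hash_eq hQ h'
  obtain ⟨w₃, rfl, hw₃⟩ := exists_eq_append_of_blocks_append_eq (List.cons.inj hC).2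
  obtain ⟨w₄, rfl, -⟩ := exists_eq_cons_of_ramp_append_hash_eq hw₃
  have hbZ : b ∉ Z ++ [c] := by simp [hb, hbc]
  have hw' : Z ++ b :: (Z ++ [c]) = (w₁ ++ t :: Z) ++ b :: w₄ := by simpa using hw
  obtain ⟨hZ, -⟩ := (List.append_cons_inj_of_notMem hb hbZ).1 hw'
  have := congrArg List.length hZ
  simp only [List.length_append, List.length_cons] at this
  omega

theorem mem_of_append_append_cons_eq_flatMap {V U L : List ℕ} (hL : ∀ s ∈ L, s ∉ Z)
    (h : V ++ (Z ++ t :: U) = L.flatMap (fun s => Z ++ [s])) : t ∈ L := by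
  induction L generalizing V with
  | nil => simp at h
  | cons s L ih =>
    rw [List.flatMap_cons, List.append_assoc, List.singleton_append] at h
    rcases append_cons_eq_append_cases h.symm with ⟨E, rfl, hE⟩ | ⟨D, hZ, hD⟩
    · exact List.mem_cons_of_mem s (ih (fun s hs => hL s (List.mem_cons_of_mem _ hs)) hE.symm)
    · rcases append_cons_eq_append_cases hD with ⟨E, rfl, -⟩ | ⟨F, rfl, hF⟩
      · exact absurd (by simp) (hL s List.mem_cons_self)
      · obtain rfl : F = [] := by
          have := congrArg List.length hZ
          simp only [List.length_append] at this
          exact List.length_eq_zero_iff.1 (by omega)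
        exact List.mem_cons.2 (Or.inl (List.cons.inj hF).1.symm)

theorem not_blocks_digit_infix (hQ : hash ∉ Q) (hz : z.length ≤ 1) (hb : b ∉ Z) (hc : c ∉ Z)
    (hbn : digit b ≠ digit (n + 1)) (hcn : digit c ≠ digit (n + 1)) :
    ¬ hash :: dollar :: blocks Z ++ [digit (n + 1)] <:+:
      Q ++ dollar :: blocks (z ++ (Z ++ b :: (Z ++ c :: Z))) ++ ramp b := by
  rintro ⟨A, C, h⟩
  have h' : A ++ hash :: dollar :: (blocks Z ++ digit (n + 1) :: (C ++ [hash, dollar])) =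
      Q ++ dollar :: blocks (z ++ [b, c, b].flatMap (fun s => Z ++ [s])) := by
    simpa [blocks, blocks_append] using congrArg (· ++ [hash, dollar]) h
  obtain ⟨w₁, t₀, w₂, hw, -, hC⟩ := exists_eq_of_append_hash_eq hQ h'
  obtain ⟨w₃, rfl, hw₃⟩ := exists_eq_append_of_blocks_append_eq (List.cons.inj hC).2
  obtain ⟨t, w₄, rfl, ht⟩ : ∃ t w₄, w₃ = t :: w₄ ∧ digit t = digit (n + 1) := by
    match w₃ with
    | [] => simp [blocks] at hw₃
    | 0 :: w₄ => simp [blocks, ramp] at hw₃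
    | (t + 1) :: w₄ => exact ⟨_, _, rfl, by simpa using (List.cons.inj hw₃).1.symm⟩
  obtain ⟨V, hV⟩ : ∃ V, V ++ (Z ++ t :: w₄) = [b, c, b].flatMap (fun s => Z ++ [s]) := by
    match z, hz with
    | [], _ => exact ⟨w₁ ++ [t₀], by simpa using hw.symm⟩
    | [s], _ =>
      match w₁ with
      | [] => exact ⟨[], (List.cons.inj hw).2.symm⟩
      | _ :: w₁ => exact ⟨w₁ ++ [t₀], by simpa using (List.cons.inj hw).2.symm⟩
  have htL := mem_of_append_append_cons_eq_flatMap (by simp [hb, hc]) hV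
  simp only [List.mem_cons, List.not_mem_nil, or_false] at htL
  rcases htL with rfl | rfl | rfl
  · exact hbn ht
  · exact hcn ht
  · exact hbn ht

end FirstOccurrence

/-! ### The lower bound for edited strings -/

section Zimin

/-- The Zimin word of order `j`, over the letters `1, …, j`. Its letters serve as the lengths of the
ramps in `blocks`. -/
def zimin : ℕ → List ℕ
  | 0 => []
  | j + 1 => zimin j ++ (j + 1) :: zimin j

variable {Q T : List Letter} {z : List ℕ} {B : Set (List Letter)} {i j k m t : ℕ}

theorem le_of_mem_zimin (h : t ∈ zimin j) : t ≤ j := by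
  induction j with
  | zero => simp [zimin] at h
  | succ j ih =>
    simp only [zimin, List.mem_append, List.mem_cons] at h
    rcases h with h | rfl | h
    · exact (ih h).trans j.le_succ
    · exact le_rfl
    · exact (ih h).trans j.le_succ

theorem notMem_zimin (h : j < t) : t ∉ zimin j :=
  fun ht => h.not_ge (le_of_mem_zimin ht)

theorem exists_zimin_eq_append_cons (h : i < k) : ∃ w, zimin k = zimin i ++ (i + 1) :: w := by
  induction k, h using Nat.le_induction with
  | base => exact ⟨_, rfl⟩
  | succ k _ ih =>
    obtain ⟨w, hw⟩ := ih
    exact ⟨w ++ (k + 1) :: zimin k, by simp [zimin, hw]⟩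

theorem digit_eq_digit_iff : digit i = digit j ↔ i % 3 = j % 3 := by
  rw [Sum.inl.injEq, ZMod.natCast_eq_natCast_iff']

theorem blocks_zimin_add_two_eq (Q : List Letter) (z : List ℕ) (i : ℕ) :
    Q ++ dollar :: blocks (z ++ zimin (i + 2)) =
      Q ++ dollar :: blocks (z ++ zimin (i + 1)) ++ ramp (i + 2) ++
        hash :: dollar :: (blocks (zimin i) ++ ramp (i + 1)) ++
          hash :: dollar :: blocks (zimin i) := by
  simp [zimin, blocks, blocks_append]

theorem Parse.boundaryCount_lt_append_ramp (h : Parse m T B) (hQ : hash ∉ Q)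
    (hz : ∀ t ∈ z, t < i + 2) (hT : Q ++ dollar :: blocks (z ++ zimin (i + 2)) <+: T) :
    boundaryCount B (Q ++ dollar :: blocks (z ++ zimin (i + 1))).length <
      boundaryCount B (Q ++ dollar :: blocks (z ++ zimin (i + 1)) ++ ramp (i + 2)).length := by
  refine h.boundaryCount_lt (a := hash) (List.IsPrefix.trans ?_ hT) (by simp [ramp])
    (not_ramp_hash_infix_blocks hQ fun t ht => ?_)
  · rw [blocks_zimin_add_two_eq]
    simp
  · rcases List.mem_append.1 ht with ht | ht
    · exact hz t ht
    · exact Nat.lt_succ_of_le (le_of_mem_zimin ht)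

theorem Parse.boundaryCount_lt_append_blocks_ramp (h : Parse m T B) (hQ : hash ∉ Q)
    (hT : Q ++ dollar :: blocks (zimin (i + 2)) <+: T) :
    boundaryCount B (Q ++ dollar :: blocks (zimin (i + 1)) ++ ramp (i + 2)).length <
      boundaryCount B (Q ++ dollar :: blocks (zimin (i + 1)) ++ ramp (i + 2) ++
        hash :: dollar :: (blocks (zimin i) ++ ramp (i + 1))).length := by
  refine h.boundaryCount_lt (a := hash) (List.IsPrefix.trans ?_ hT) (by simp)
    (not_blocks_ramp_hash_infix hQ (notMem_zimin i.lt_succ_self) (by omega))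
  have := blocks_zimin_add_two_eq Q [] i
  simp only [List.nil_append] at this
  rw [this]
  simp

theorem Parse.boundaryCount_lt_blocks_zimin (h : Parse m T B) (hQ : hash ∉ Q) (hz : z.length ≤ 1)
    (hT : Q ++ dollar :: blocks (z ++ zimin (i + 2)) ++ [digit (i + 3)] <+: T) :
    boundaryCount B (Q ++ dollar :: blocks (z ++ zimin (i + 1)) ++ ramp (i + 2) ++
        hash :: dollar :: (blocks (zimin i) ++ ramp (i + 1))).length <
      boundaryCount B (Q ++ dollar :: blocks (z ++ zimin (i + 2))).length := by
  rw [blocks_zimin_add_two_eq] at hT ⊢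
  refine h.boundaryCount_lt hT (by simp) ?_
  have hnew := not_blocks_digit_infix (Z := zimin i) (b := i + 1) (c := i + 2) (n := i + 2) hQ hz
    (notMem_zimin (by omega)) (notMem_zimin (by omega))
    (by rw [Ne, digit_eq_digit_iff]; omega) (by rw [Ne, digit_eq_digit_iff]; omega)
  simpa [zimin, blocks, blocks_append] using hnew

/-- The number of phrases that each level of the Zimin word forces, if the list `z` of blocks comes
before the Zimin word. -/
def levelCost : List ℕ → ℕ
  | [] => 3
  | _ => 2

theorem Parse.boundaryCount_zimin_add_two (h : Parse m T B) (hQ : hash ∉ Q) (hz : z.length ≤ 1)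
    (hzi : ∀ t ∈ z, t < i + 2)
    (hT : Q ++ dollar :: blocks (z ++ zimin (i + 2)) ++ [digit (i + 3)] <+: T) :
    boundaryCount B (Q ++ dollar :: blocks (z ++ zimin (i + 1))).length + levelCost z ≤
      boundaryCount B (Q ++ dollar :: blocks (z ++ zimin (i + 2))).length := by
  have hT' := (List.prefix_append _ [digit (i + 3)]).trans hT
  have first := h.boundaryCount_lt_append_ramp hQ hzi hT'
  have last := h.boundaryCount_lt_blocks_zimin hQ hz hT
  match z with
  | [] =>
    have middle := h.boundaryCount_lt_append_blocks_ramp hQ hT'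
    simp only [List.nil_append, levelCost] at *
    omega
  | s :: z =>
    have middle := h.boundaryCount_mono (List.prefix_append
      (Q ++ dollar :: blocks (s :: z ++ zimin (i + 1)) ++ ramp (i + 2))
      (hash :: dollar :: (blocks (zimin i) ++ ramp (i + 1)))).length_le
    simp only [levelCost]
    omega

theorem Parse.levelCost_mul_le (h : Parse m T B) (hQ : hash ∉ Q) (hz : z.length ≤ 1)
    (hz' : ∀ t ∈ z, t < 2) (hT : Q ++ dollar :: blocks (z ++ zimin k) <+: T) :
    levelCost z * k ≤ m + 1 + levelCost z * 2 := by
  have count (i : ℕ) (hi : i + 2 ≤ k) : levelCost z * i ≤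
      boundaryCount B (Q ++ dollar :: blocks (z ++ zimin (i + 1))).length := by
    induction i with
    | zero => exact Nat.zero_le _
    | succ i ih =>
      obtain ⟨w, hw⟩ := exists_zimin_eq_append_cons (show i + 2 < k by omega)
      refine le_trans ?_ (h.boundaryCount_zimin_add_two hQ hz
        (fun t ht => (hz' t ht).trans_le (by omega)) (List.IsPrefix.trans ?_ hT))
      · rw [mul_add_one]
        exact Nat.add_le_add_right (ih (by omega)) _
      · rw [hw]
        simp [blocks, blocks_append, ramp]
  rcases le_total k 2 with hk | hk
  · exact (Nat.mul_le_mul_left _ hk).trans (Nat.le_add_left _ _)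
  · obtain ⟨i, rfl⟩ := Nat.exists_eq_add_of_le' hk
    rw [mul_add]
    exact Nat.add_le_add_right ((count i le_rfl).trans h.boundaryCount_le) _

end Zimin

/-! ### The upper bound for the original strings -/

section UpperBound

variable {α : Type*} {i j n N s : ℕ}

theorem ramp_add_three_mul (i m : ℕ) : ramp (i + 3 * m) = ramp i ++ ramp (3 * m) := by
  induction i with
  | zero => simp [ramp]
  | succ i ih =>
    rw [Nat.add_right_comm, ramp, ih, ramp, List.cons_append,
      digit_eq_digit_iff.2 (show (i + 3 * m + 1) % 3 = (i + 1) % 3 by omega)]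

theorem ramp_suffix_ramp (h : i ≤ j) : ramp i <:+ ramp j := by
  induction j, h using Nat.le_induction with
  | base => exact List.suffix_rfl
  | succ j _ ih => exact ih.trans (List.suffix_cons _ _)

theorem exists_parse_ramp (s : ℕ) : ∃ B, Parse (3 + s) (ramp (3 * 2 ^ s)) B := by
  induction s with
  | zero => exact Parse.exists_of_length (ramp 3)
  | succ s ih =>
    obtain ⟨B, hB⟩ := ih
    rw [pow_succ, mul_two, mul_add, ramp_add_three_mul]
    exact ⟨_, hB.snoc (Or.inr ⟨_, hB.self_mem, List.suffix_rfl⟩)⟩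

theorem exists_parse_blocks_zimin (hj : j ≤ 3 * 2 ^ s) :
    ∃ B, Parse (5 + s + j) (blocks (3 * 2 ^ s :: zimin j)) B := by
  induction j with
  | zero =>
    obtain ⟨B, hB⟩ := exists_parse_ramp s
    have h := (hB.snoc (f := [hash]) (Or.inl le_rfl)).snoc (f := [dollar]) (Or.inl le_rfl)
    rw [show 3 + s + 1 + 1 = 5 + s + 0 by ring] at h
    exact ⟨_, by simpa [zimin, blocks] using h⟩
  | succ j ih =>
    obtain ⟨B, hB⟩ := ih (by omega)
    obtain ⟨R, hR⟩ := ramp_suffix_ramp hj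
    have hcopy : blocks ((j + 1) :: zimin j) <:+ blocks (3 * 2 ^ s :: zimin j) :=
      ⟨R, by rw [blocks, blocks, ← hR, List.append_assoc]⟩
    have h := hB.snoc (Or.inr ⟨_, hB.self_mem, hcopy⟩)
    rw [← blocks_append] at h
    exact ⟨_, h⟩

theorem Parse.exists_append_of_le_two_mul {T : List α} {B : Set (List α)} (h : Parse n T B)
    (hle : T.length ≤ N) (hN : N ≤ 2 * T.length) :
    ∃ pad, (T ++ pad).length = N ∧ ∃ C, Parse (n + 1) (T ++ pad) C := by
  refine ⟨T.drop (2 * T.length - N), ?_, _,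
    h.snoc (Or.inr ⟨T, h.self_mem, List.drop_suffix _ _⟩)⟩
  rw [List.length_append, List.length_drop]
  omega

theorem Parse.exists_append_of_le_four_mul {T : List α} {B : Set (List α)} (h : Parse n T B)
    (hle : T.length ≤ N) (hN : N ≤ 4 * T.length) :
    ∃ pad, (T ++ pad).length = N ∧ ∃ C, Parse (n + 2) (T ++ pad) C := by
  obtain ⟨pad, hlen, C, hC⟩ := h.exists_append_of_le_two_mul (N := min N (2 * T.length))
    (by omega) (by omega)
  obtain ⟨pad', hlen', C', hC'⟩ := hC.exists_append_of_le_two_mul (N := N) (by omega) (by omega)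
  exact ⟨pad ++ pad', by rwa [← List.append_assoc], C', by rwa [← List.append_assoc]⟩

theorem length_blocks_zimin (k : ℕ) : (blocks (zimin k)).length + k + 4 = 2 ^ (k + 2) := by
  induction k with
  | zero => rfl
  | succ k ih =>
    simp only [zimin, blocks_append, blocks, List.length_append, List.length_cons, length_ramp]
    rw [pow_succ, ← ih]
    ring

theorem lt_two_mul_two_pow_log (k : ℕ) : k < 2 * 2 ^ Nat.log 2 k := by
  rw [mul_comm, ← pow_succ]
  exact Nat.lt_pow_succ_log_self one_lt_two k

theorem two_pow_le_length_blocks_zimin (k : ℕ) :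
    2 ^ (k + 2) ≤ (blocks (3 * 2 ^ Nat.log 2 k :: zimin k)).length := by
  have := length_blocks_zimin k
  have := lt_two_mul_two_pow_log k
  have := Nat.one_le_two_pow (n := Nat.log 2 k)
  simp only [blocks, List.length_append, List.length_cons, length_ramp]
  omega

theorem length_blocks_zimin_le_two_pow (k : ℕ) :
    (blocks (3 * 2 ^ Nat.log 2 k :: zimin k)).length ≤ 2 ^ (k + 3) := by
  rcases eq_or_ne k 0 with rfl | hk
  · simp [blocks, zimin, length_ramp]
  have := length_blocks_zimin k
  have := Nat.pow_log_le_self 2 hk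
  have := Nat.lt_two_pow_self (n := k)
  simp only [blocks, List.length_append, List.length_cons, length_ramp, pow_succ] at *
  omega

end UpperBound

/-! ### Worst-case edits -/

section WorstCase

variable {k n : ℕ}

theorem exists_parse_blocks_zimin_append (hn : 2 ^ (k + 3) ≤ n) (hn' : n ≤ 2 ^ (k + 4)) :
    ∃ R pad B, hash ∉ R ∧ (R ++ hash :: dollar :: (blocks (zimin k) ++ pad)).length = n ∧
      Parse (k + Nat.log 2 k + 7) (R ++ hash :: dollar :: (blocks (zimin k) ++ pad)) B := by
  obtain ⟨B, hB⟩ := exists_parse_blocks_zimin (j := k) (s := Nat.log 2 k)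
    (by have := lt_two_mul_two_pow_log k; omega)
  have hlen := two_pow_le_length_blocks_zimin k
  obtain ⟨pad, hpad, C, hC⟩ := hB.exists_append_of_le_four_mul
    ((length_blocks_zimin_le_two_pow k).trans hn) (by rw [pow_succ, pow_succ] at hn'; omega)
  refine ⟨ramp (3 * 2 ^ Nat.log 2 k), pad, C, hash_notMem_ramp _, ?_, ?_⟩
  · simpa [blocks] using hpad
  · rw [show k + Nat.log 2 k + 7 = 5 + Nat.log 2 k + k + 2 by ring]
    simpa [blocks] using hC

theorem levelCost_mul_le_zEndOpt {Q : List Letter} {z : List ℕ} (hQ : hash ∉ Q)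
    (hz : z.length ≤ 1) (hz' : ∀ t ∈ z, t < 2) (k : ℕ) (pad : List Letter) :
    levelCost z * k ≤
      zEndOpt (Q ++ dollar :: (blocks (z ++ zimin k) ++ pad)) + 1 + levelCost z * 2 := by
  obtain ⟨B, hB⟩ := exists_parse_zEndOpt (Q ++ dollar :: (blocks (z ++ zimin k) ++ pad))
  exact hB.levelCost_mul_le hQ hz hz' ⟨pad, by simp⟩

/-- The edit removes the first `hash` or separates it from the long ramp, all of whose suffixes
were sources of copies that extend across this `hash`. -/
theorem exists_isEdit_letter (e : Edit) (hn : 2 ^ (k + 3) ≤ n) (hn' : n ≤ 2 ^ (k + 4)) :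
    ∃ T T' : List Letter, T.length = n ∧ IsEdit e T T' ∧
      zEndOpt T ≤ k + Nat.log 2 k + 7 ∧ msValue e * k ≤ zEndOpt T' + 1 + msValue e * 2 := by
  obtain ⟨R, pad, B, hR, hlen, hB⟩ := exists_parse_blocks_zimin_append hn hn'
  cases e with
  | sub =>
    have lower := levelCost_mul_le_zEndOpt (Q := R ++ [dollar]) (z := []) (by simp [hR])
      zero_le_one (by simp) k pad
    rw [List.append_assoc] at lower
    exact ⟨_, _, hlen, ⟨R, _, hash, dollar, by simp, rfl, rfl⟩, hB.zEndOpt_le, lower⟩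
  | ins =>
    have lower := levelCost_mul_le_zEndOpt (z := [0]) hR le_rfl (by simp) k pad
    exact ⟨_, _, hlen, ⟨R, _, dollar, rfl, rfl⟩, hB.zEndOpt_le, lower⟩
  | del =>
    have lower := levelCost_mul_le_zEndOpt (z := []) hR zero_le_one (by simp) k pad
    exact ⟨_, _, hlen, ⟨R, _, hash, rfl, rfl⟩, hB.zEndOpt_le, lower⟩

end WorstCase

/-! ### Change of alphabet -/

section Map

variable {α β : Type*} {T T' : List α} {f : α → β}

theorem Parse.map {n : ℕ} {B : Set (List α)} (h : Parse n T B) (f : α → β) :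
    Parse n (T.map f) (List.map f '' B) := by
  induction h with
  | nil => simpa using Parse.nil
  | snoc h hg ih =>
    rw [Set.image_insert_eq, List.map_append]
    refine ih.snoc (hg.imp (fun hlen => by simpa using hlen) ?_)
    rintro ⟨P, hP, hgP⟩
    exact ⟨_, Set.mem_image_of_mem _ hP, hgP.map f⟩

theorem zEndOpt_map_le (T : List α) (f : α → β) : zEndOpt (T.map f) ≤ zEndOpt T := by
  obtain ⟨B, h⟩ := exists_parse_zEndOpt T
  exact (h.map f).zEndOpt_le

theorem zEndOpt_map (hf : f.Injective) (T : List α) : zEndOpt (T.map f) = zEndOpt T := by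
  refine (zEndOpt_map_le T f).antisymm ?_
  rcases isEmpty_or_nonempty α with hα | hα
  · rw [Subsingleton.elim T [], List.map_nil]
    exact (zEndOpt_le_length []).trans (Nat.zero_le _)
  · obtain ⟨g, hg⟩ := hf.hasLeftInverse
    simpa [hg.id] using zEndOpt_map_le (T.map f) g

theorem IsEdit.map {e : Edit} (h : IsEdit e T T') (hf : f.Injective) :
    IsEdit e (T.map f) (T'.map f) := by
  cases e with
  | sub =>
    obtain ⟨u, v, a, b, hab, rfl, rfl⟩ := h
    exact ⟨u.map f, v.map f, f a, f b, hf.ne hab, by simp, by simp⟩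
  | ins =>
    obtain ⟨u, v, b, rfl, rfl⟩ := h
    exact ⟨u.map f, v.map f, f b, by simp, by simp⟩
  | del =>
    obtain ⟨u, v, a, rfl, rfl⟩ := h
    exact ⟨u.map f, v.map f, f a, by simp, by simp⟩

theorem exists_letter_injective {α : Type*} (hα : 5 ≤ ENat.card α) :
    ∃ f : Letter → α, f.Injective := by
  obtain ⟨f, -⟩ := Fin.Embedding.exists_embedding_disjoint_range_of_add_le_ENat_card
    (s := (∅ : Set α)) (n := Fintype.card Letter) (by simpa [Letter] using hα)
  exact ⟨_, f.injective.comp (Fintype.equivFin Letter).injective⟩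

end Map

/-! ### The multiplicative sensitivity -/

section Sensitivity

variable {α : Type*} {e : Edit} {T T' : List α} {n : ℕ}

theorem IsEdit.length_le (h : IsEdit e T T') : T'.length ≤ T.length + 1 := by
  cases e with
  | sub => obtain ⟨u, v, a, b, -, rfl, rfl⟩ := h; simp
  | ins => obtain ⟨u, v, b, rfl, rfl⟩ := h; simp [add_assoc]
  | del => obtain ⟨u, v, a, rfl, rfl⟩ := h; simp [add_assoc]

theorem ratios_nonempty [Nontrivial α] (e : Edit) (c : List α → ℕ) (hn : 1 ≤ n) :
    (ratios e c n).Nonempty := by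
  obtain ⟨a, b, hab⟩ := exists_pair_ne α
  obtain ⟨n, rfl⟩ := Nat.exists_eq_add_of_le' hn
  suffices ∃ T', IsEdit e (a :: List.replicate n a) T' by
    obtain ⟨T', hT'⟩ := this
    exact ⟨_, _, T', by simp, hT', rfl⟩
  cases e with
  | sub => exact ⟨_, [], _, a, b, hab, rfl, rfl⟩
  | ins => exact ⟨_, [], _, b, rfl, rfl⟩
  | del => exact ⟨_, [], _, a, rfl, rfl⟩

theorem ratios_finite (e : Edit) (n : ℕ) : (ratios e (zEndOpt (α := α)) n).Finite := by
  refine ((Set.finite_Iic (n + 1)).image2 (fun p q : ℕ => (p : ℝ) / q)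
    (Set.finite_Iic n)).subset ?_
  rintro r ⟨T, T', rfl, hTT', rfl⟩
  exact Set.mem_image2_of_mem ((zEndOpt_le_length T').trans hTT'.length_le) (zEndOpt_le_length T)

theorem isGreatest_MS [Nontrivial α] (e : Edit) (hn : 1 ≤ n) :
    IsGreatest (ratios e (zEndOpt (α := α)) n) (MS e (zEndOpt (α := α)) n) :=
  ⟨(ratios_nonempty e _ hn).csSup_mem (ratios_finite e n),
    fun _ hr => le_csSup (ratios_finite e n).bddAbove hr⟩

theorem MS_le_msValue (α : Type*) (e : Edit) (hn : 1 ≤ n) :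
    MS e (zEndOpt (α := α)) n ≤ msValue e := by
  refine Real.sSup_le ?_ (Nat.cast_nonneg _)
  rintro r ⟨T, T', hT, hTT', rfl⟩
  have hne : T ≠ [] := List.ne_nil_of_length_pos (hT ▸ hn)
  rw [div_le_iff₀ (Nat.cast_pos.2 (zEndOpt_pos hne))]
  exact_mod_cast zEndOpt_le_of_isEdit hne hTT'

theorem le_MS (hα : 5 ≤ ENat.card α) (e : Edit) {k : ℕ} (hn : 2 ^ (k + 3) ≤ n)
    (hn' : n ≤ 2 ^ (k + 4)) :
    ((msValue e : ℝ) * k - (1 + msValue e * 2)) / (k + Nat.log 2 k + 7) ≤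
      MS e (zEndOpt (α := α)) n := by
  obtain ⟨f, hf⟩ := exists_letter_injective hα
  obtain ⟨T, T', hT, hTT', hupper, hlower⟩ := exists_isEdit_letter e hn hn'
  have hratio : (zEndOpt T' : ℝ) / zEndOpt T ≤ MS e (zEndOpt (α := α)) n :=
    le_csSup (ratios_finite e n).bddAbove ⟨T.map f, T'.map f, by rw [List.length_map, hT],
      hTT'.map hf, by rw [zEndOpt_map hf, zEndOpt_map hf]⟩
  refine le_trans ?_ hratio
  have hne : T ≠ [] := List.ne_nil_of_length_pos (hT ▸ (Nat.two_pow_pos _).trans_le hn)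
  refine div_le_div₀ (Nat.cast_nonneg _) ?_ (Nat.cast_pos.2 (zEndOpt_pos hne))
    (by exact_mod_cast hupper)
  rw [sub_le_iff_le_add, ← add_assoc]
  exact_mod_cast hlower

theorem tendsto_natLog_div_atTop (b : ℕ) :
    Filter.Tendsto (fun k : ℕ => (Nat.log b k : ℝ) / k) Filter.atTop (nhds 0) := by
  have hlog := (Real.isLittleO_log_id_atTop.tendsto_div_nhds_zero.comp
    (tendsto_natCast_atTop_atTop (R := ℝ))).div_const (Real.log b)
  rw [zero_div] at hlog
  refine squeeze_zero (fun k => by positivity) (fun k => ?_) hlog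
  simp only [Function.comp_apply, id]
  rw [div_right_comm]
  exact div_le_div_of_nonneg_right (Real.natLog_le_logb k b) (Nat.cast_nonneg _)

theorem tendsto_mul_sub_div_add_natLog (s c d : ℝ) (b : ℕ) :
    Filter.Tendsto (fun k : ℕ => (s * k - c) / (k + Nat.log b k + d)) Filter.atTop (nhds s) := by
  have hnum := (tendsto_const_div_atTop_nhds_zero_nat c).const_sub s
  have hden := ((tendsto_natLog_div_atTop b).const_add 1).add
    (tendsto_const_div_atTop_nhds_zero_nat d)
  have h := hnum.div hden (by norm_num)
  simp only [sub_zero, add_zero, div_one] at h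
  refine h.congr' ((Filter.eventually_ne_atTop 0).mono fun k hk => ?_)
  have hk' : (k : ℝ) ≠ 0 := Nat.cast_ne_zero.2 hk
  rw [Pi.div_apply, ← mul_div_mul_right _ _ hk']
  congr 1 <;> field_simp

theorem tendsto_MS (hα : 5 ≤ ENat.card α) (e : Edit) :
    Filter.Tendsto (MS e (zEndOpt (α := α))) Filter.atTop (nhds (msValue e)) := by
  have hlog : Filter.Tendsto (fun n => Nat.log 2 n - 3) Filter.atTop Filter.atTop :=
    (Filter.tendsto_sub_atTop_nat 3).comp (Filter.tendsto_atTop_atTop_of_monotone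
      Nat.log_monotone fun k => ⟨2 ^ k, (Nat.log_pow one_lt_two k).ge⟩)
  refine tendsto_of_tendsto_of_tendsto_of_le_of_le'
    ((tendsto_mul_sub_div_add_natLog _ (1 + msValue e * 2) 7 2).comp hlog) tendsto_const_nhds ?_
    ((Filter.eventually_ge_atTop 1).mono fun n hn => MS_le_msValue α e hn)
  filter_upwards [Filter.eventually_ge_atTop (2 ^ 3)] with n hn
  have hn0 : n ≠ 0 := by omega
  have h3 : 3 ≤ Nat.log 2 n := Nat.le_log_of_pow_le one_lt_two hn
  refine le_MS hα e ?_ ?_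
  · rw [Nat.sub_add_cancel h3]
    exact Nat.pow_log_le_self 2 hn0
  · rw [show Nat.log 2 n - 3 + 4 = Nat.log 2 n + 1 by omega]
    exact (Nat.lt_pow_succ_log_self one_lt_two n).le

end Sensitivity

end LZEnd

theorem mainTheorem6_general (α : Type*) :
    (∀ (e : LZEnd.Edit) (T T' : List α), T ≠ [] → LZEnd.IsEdit e T T' →
      LZEnd.zEndOpt T' ≤ LZEnd.msValue e * LZEnd.zEndOpt T) ∧
    (Nontrivial α → ∀ (e : LZEnd.Edit) (n : ℕ), 1 ≤ n →
      IsGreatest (LZEnd.ratios e (LZEnd.zEndOpt (α := α)) n)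
        (LZEnd.MS e (LZEnd.zEndOpt (α := α)) n) ∧
      LZEnd.MS e (LZEnd.zEndOpt (α := α)) n ≤ (LZEnd.msValue e : ℝ)) ∧
    (5 ≤ ENat.card α → ∀ e : LZEnd.Edit,
      Filter.Tendsto (fun n : ℕ => LZEnd.MS e (LZEnd.zEndOpt (α := α)) n) Filter.atTop
        (nhds (LZEnd.msValue e : ℝ))) :=
  ⟨fun _ _ _ hT h => LZEnd.zEndOpt_le_of_isEdit hT h,
    fun _ e _ hn => ⟨LZEnd.isGreatest_MS e hn, LZEnd.MS_le_msValue α e hn⟩,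
    fun hα e => LZEnd.tendsto_MS hα e⟩

theorem mainTheorem6 (α : Type*) :
    (∀ (e : LZEnd.Edit) (T T' : List α), T ≠ [] → LZEnd.IsEdit e T T' →
      LZEnd.zEndOpt T' ≤ LZEnd.msValue e * LZEnd.zEndOpt T) ∧
    (Infinite α → ∀ e : LZEnd.Edit,
      (∀ n : ℕ, 1 ≤ n →
        IsGreatest (LZEnd.ratios e (LZEnd.zEndOpt (α := α)) n)
          (LZEnd.MS e (LZEnd.zEndOpt (α := α)) n) ∧
        LZEnd.MS e (LZEnd.zEndOpt (α := α)) n ≤ (LZEnd.msValue e : ℝ)) ∧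
      Filter.Tendsto (fun n : ℕ => LZEnd.MS e (LZEnd.zEndOpt (α := α)) n) Filter.atTop
        (nhds (LZEnd.msValue e : ℝ))) := by
  obtain ⟨bound, greatest, limit⟩ := mainTheorem6_general α
  exact ⟨bound, fun _ e => ⟨greatest inferInstance e, limit (by simp) e⟩⟩
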